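/- Let $P\subset\mathbb{R}^n$ be a lattice polytope, that is, the convex hull of a non-empty finite subset of $\mathbb{Z}^n$. Let $E_P$ be its Ehrhart polynomial, the polynomial with $E_P(m)=|mP\cap\mathbb{Z}^n|$ for all integers $m>0$. Call $P$ *reflexive* if $P^*=\{y\in\mathbb{R}^n:\langle x,y\rangle\le 1\text{ for all }x\in P\}$ is also a lattice polytope, and a *CL-polytope* if it is reflexive and every complex root $z$ of $E_P$ satisfies $\operatorname{Re}(z)=-\tfrac12$. A real polynomial $f$ of degree $e$ is *magic positive* if $f(x)=\sum_{i=0}^{e} b_i x^i(x+1)^{e-i}$ with all $b_i\ge 0$. Put $$\mathrm{m\text{-}index}(P)=\min\{k\in\mathbb{Z}_{>0}: E_{kP}\text{ is magic positive}\}.$$ If $P$ is a CL-polytope of dimension $d$, then this minimum exists and is bounded above by a quantity that depends only on $d$; explicitly, $$\mathrm{m\text{-}index}(P)\le\left\lceil \tfrac12+2d^2\left(d-\tfrac12\right)^2\right\rceil .$$ -/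

import Mathlib

open Polynomial
open scoped Pointwise

noncomputable section

/-- The point of `ℝⁿ` with integer coordinates `z`. -/
def intPoint {n : ℕ} (z : Fin n → ℤ) : Fin n → ℝ := fun i => (z i : ℝ)

/-- A lattice polytope in `ℝⁿ`: the convex hull of finitely many (at least one) points of `ℤⁿ`. -/
def IsLatticePolytope {n : ℕ} (P : Set (Fin n → ℝ)) : Prop :=
  ∃ S : Finset (Fin n → ℤ), S.Nonempty ∧ P = convexHull ℝ (intPoint '' (S : Set (Fin n → ℤ)))

/-- The dimension of a set in `ℝⁿ`: the dimension of its affine hull. -/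
def polytopeDim {n : ℕ} (P : Set (Fin n → ℝ)) : ℕ :=
  Module.finrank ℝ (vectorSpan ℝ P)

/-- The dual `P* = {y : ⟨x, y⟩ ≤ 1 for all x ∈ P}`, for the usual inner product of `ℝⁿ`. -/
def dualPolytope {n : ℕ} (P : Set (Fin n → ℝ)) : Set (Fin n → ℝ) :=
  {y | ∀ x ∈ P, x ⬝ᵥ y ≤ 1}

/-- A lattice polytope is reflexive if its dual is a lattice polytope too. -/
def IsReflexivePolytope {n : ℕ} (P : Set (Fin n → ℝ)) : Prop :=
  IsLatticePolytope P ∧ IsLatticePolytope (dualPolytope P)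

/-- The number `|P ∩ ℤⁿ|` of lattice points of `P`. -/
def latticePointCount {n : ℕ} (P : Set (Fin n → ℝ)) : ℕ :=
  Set.ncard {z : Fin n → ℤ | intPoint z ∈ P}

/-- `E` counts the lattice points of all dilates `mP`, `m = 1, 2, 3, …`. -/
def CountsDilates {n : ℕ} (P : Set (Fin n → ℝ)) (E : ℝ[X]) : Prop :=
  ∀ m : ℕ, 0 < m → E.eval (m : ℝ) = (latticePointCount ((m : ℝ) • P) : ℝ)

open Classical in
/-- The Ehrhart polynomial of `P`: the polynomial `E` with `E(m) = |mP ∩ ℤⁿ|` for all integers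
`m > 0`. (For a set `P` that has no such polynomial, which is never a lattice polytope, the value
is `0`.) -/
def ehrhartPolynomial {n : ℕ} (P : Set (Fin n → ℝ)) : ℝ[X] :=
  if h : ∃ E : ℝ[X], CountsDilates P E then h.choose else 0

/-- There is at most one polynomial that counts the lattice points of the dilates. -/
theorem CountsDilates.eq_ehrhartPolynomial {n : ℕ} {P : Set (Fin n → ℝ)} {E : ℝ[X]}
    (hE : CountsDilates P E) : ehrhartPolynomial P = E := by
  have h : ∃ E : ℝ[X], CountsDilates P E := ⟨E, hE⟩
  rw [ehrhartPolynomial, dif_pos h]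
  have hF := h.choose_spec
  refine Polynomial.eq_of_infinite_eval_eq _ _ (Set.Infinite.mono ?_
    (Set.infinite_range_of_injective
      (f := fun m : ℕ => ((m + 1 : ℕ) : ℝ)) (fun a b hab => by simpa using hab)))
  rintro _ ⟨m, rfl⟩
  exact (hF (m + 1) m.succ_pos).trans (hE (m + 1) m.succ_pos).symm

/-- A CL-polytope: a reflexive polytope all of whose complex Ehrhart roots have real part `-1/2`. -/
def IsCLPolytope {n : ℕ} (P : Set (Fin n → ℝ)) : Prop :=
  IsReflexivePolytope P ∧ ∀ z : ℂ, aeval z (ehrhartPolynomial P) = 0 → z.re = -(1 / 2)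

/-- A polynomial `f` of degree `d` is magic positive if `f = ∑ bᵢ xⁱ (x + 1)^(d - i)`, the sum over
`0 ≤ i ≤ d`, with all `bᵢ ≥ 0`. -/
def MagicPositive (f : ℝ[X]) : Prop :=
  ∃ b : ℕ → ℝ, (∀ i ≤ f.natDegree, 0 ≤ b i) ∧
    f = ∑ i ∈ Finset.range (f.natDegree + 1), C (b i) * X ^ i * (X + 1) ^ (f.natDegree - i)

/-- The positive integers `k` for which the Ehrhart polynomial of `kP` is magic positive. -/
def magicDilations {n : ℕ} (P : Set (Fin n → ℝ)) : Set ℕ :=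
  {k | 0 < k ∧ MagicPositive (ehrhartPolynomial ((k : ℝ) • P))}

/-- The m-index of `P`: the least positive integer `k` such that the Ehrhart polynomial of `kP` is
magic positive (`0` if there is none). -/
def mIndex {n : ℕ} (P : Set (Fin n → ℝ)) : ℕ :=
  sInf (magicDilations P)

end

/-! Roots on `Re z = -1/2` make `E` a positive multiple of a product of factors `x + 1/2` and `(x +
1/2)² + t²`. Replacing `P` by `kP` substitutes `kx` for `x`, and each factor then lies in the magic
cone as soon as `k ≥ 1/2 + 2t²` (`MagicCone.quadratic_mul`). Products preserve the cone, so it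
remains to bound `t` in terms of the dimension (`sq_le_of_countsDilates`).

The bound comes from counting. Independent lattice vectors `vᵢ ∈ P` give disjoint families `N x + ∑
kᵢ vᵢ` inside `N M P` (`sum_latticePointCount_smul_le`). Averaging over `k`, dividing by `Nⁿ` and
letting `N → ∞` gives `g (M - (n + 1) / 2) ≤ v Mⁿ` for each suitably convex `g` with `g (m + 1/2) ≤
E m`, where `v` is the leading coefficient (`CountsDilates.le_coeff_mul_pow`). Taking `g y = v (yⁿ +
t² yⁿ⁻²)` bounds `t`.

Reflexivity enters only through compactness of the dual: it puts `0` in `P` and makes `P` span the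
space. -/

/-! ### The cone of magic positive polynomials -/

/-- The polynomials `∑ bᵢ xⁱ (x + 1)^(m - i)`, `0 ≤ i ≤ m`, with all `bᵢ ≥ 0`. -/
def MagicCone (m : ℕ) (f : ℝ[X]) : Prop :=
  ∃ b : ℕ → ℝ, (∀ i ≤ m, 0 ≤ b i) ∧
    f = ∑ i ∈ Finset.range (m + 1), C (b i) * X ^ i * (X + 1) ^ (m - i)

namespace MagicCone

theorem add {m : ℕ} {f g : ℝ[X]} (hf : MagicCone m f) (hg : MagicCone m g) :
    MagicCone m (f + g) := by
  obtain ⟨b, hb, rfl⟩ := hf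
  obtain ⟨c, hc, rfl⟩ := hg
  refine ⟨fun i => b i + c i, fun i hi => add_nonneg (hb i hi) (hc i hi), ?_⟩
  rw [← Finset.sum_add_distrib]
  refine Finset.sum_congr rfl fun i _ => ?_
  rw [C_add]
  ring

theorem C_mul {m : ℕ} {f : ℝ[X]} {c : ℝ} (hc : 0 ≤ c) (hf : MagicCone m f) :
    MagicCone m (C c * f) := by
  obtain ⟨b, hb, rfl⟩ := hf
  refine ⟨fun i => c * b i, fun i hi => mul_nonneg hc (hb i hi), ?_⟩
  rw [Finset.mul_sum]
  refine Finset.sum_congr rfl fun i _ => ?_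
  rw [Polynomial.C_mul]
  ring

theorem X_mul {m : ℕ} {f : ℝ[X]} (hf : MagicCone m f) : MagicCone (m + 1) (X * f) := by
  obtain ⟨b, hb, rfl⟩ := hf
  refine ⟨fun i => if i = 0 then 0 else b (i - 1), fun i hi => ?_, ?_⟩
  · dsimp only
    split_ifs with h
    · exact le_rfl
    · exact hb _ (by omega)
  · rw [Finset.sum_range_succ' _ (m + 1), Finset.mul_sum]
    simp only [Nat.add_eq_zero_iff, one_ne_zero, and_false, if_false, Nat.add_sub_cancel, if_true,
      C_0, zero_mul, add_zero, Nat.add_sub_add_right]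
    refine Finset.sum_congr rfl fun i _ => ?_
    ring

theorem X_add_one_mul {m : ℕ} {f : ℝ[X]} (hf : MagicCone m f) :
    MagicCone (m + 1) ((X + 1) * f) := by
  obtain ⟨b, hb, rfl⟩ := hf
  refine ⟨fun i => if i ≤ m then b i else 0, fun i _ => ?_, ?_⟩
  · dsimp only
    split_ifs with h
    · exact hb _ h
    · exact le_rfl
  · rw [Finset.sum_range_succ _ (m + 1), Finset.mul_sum]
    simp only [show ¬ (m + 1 ≤ m) by omega, if_false, C_0, zero_mul, add_zero]
    refine Finset.sum_congr rfl fun i hi => ?_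
    have hi' : i ≤ m := by simpa [Nat.lt_succ_iff] using hi
    rw [if_pos hi', Nat.sub_add_comm hi']
    ring

theorem const {c : ℝ} (hc : 0 ≤ c) : MagicCone 0 (C c) :=
  ⟨fun _ => c, fun _ _ => hc, by simp⟩

theorem linear_mul {m : ℕ} {f : ℝ[X]} (hf : MagicCone m f) {k : ℝ} (hk : 1 / 2 ≤ k) :
    MagicCone (m + 1) ((C k * X + C (1 / 2)) * f) := by
  have h := (hf.X_mul.C_mul (sub_nonneg.2 hk)).add
    (hf.X_add_one_mul.C_mul (c := 1 / 2) (by norm_num))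
  convert h using 1
  rw [C_sub]
  ring

/-- Write `kX + 1/2 = (k - 1/2) X + (1/2) (X + 1)` and `t² = t² ((X + 1) - X)²`. Only the
coefficient `k - 1/2 - 2t²` of `X (X + 1)` can be negative, whence the condition on `k`. -/
theorem quadratic_mul {m : ℕ} {f : ℝ[X]} (hf : MagicCone m f) {k t : ℝ}
    (hk : 1 / 2 + 2 * t ^ 2 ≤ k) :
    MagicCone (m + 2) (((C k * X + C (1 / 2)) ^ 2 + C (t ^ 2)) * f) := by
  have h := ((hf.X_mul.X_mul.C_mul (c := (k - 1 / 2) ^ 2 + t ^ 2) (by positivity)).add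
    (hf.X_add_one_mul.X_mul.C_mul (c := k - 1 / 2 - 2 * t ^ 2) (by linarith))).add
    (hf.X_add_one_mul.X_add_one_mul.C_mul (c := 1 / 4 + t ^ 2) (by positivity))
  convert h using 1
  have h2 : (C (1 / 4) : ℝ[X]) = C (1 / 2) ^ 2 := by rw [← C_pow]; norm_num
  have h3 : (C 2 : ℝ[X]) = 2 := rfl
  have h4 : (2 : ℝ[X]) * C (1 / 2) = 1 := by
    rw [← h3, ← Polynomial.C_mul]; norm_num
  simp only [C_sub, C_add, Polynomial.C_mul, C_pow, h2, h3]
  generalize (C (1 / 2) : ℝ[X]) = w at *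
  linear_combination (C k * X + C k * X ^ 2 - w * X - w * X ^ 2) * f * h4

end MagicCone

/-! ### Polynomials with all roots on the critical line -/

/-- The polynomial `v (x + 1/2)ᵃ ∏ ((x + 1/2)² + t²)`, whose roots lie on `Re z = -1/2`. -/
noncomputable def criticalLineProduct (v : ℝ) (a : ℕ) (ts : List ℝ) : ℝ[X] :=
  C v * (X + C (1 / 2)) ^ a * (ts.map fun t => (X + C (1 / 2)) ^ 2 + C (t ^ 2)).prod

/-- Induction on the degree: a real root splits off `X + 1/2`, a conjugate pair splits off a
quadratic with `t` its imaginary part. -/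
theorem exists_eq_criticalLineProduct (f : ℝ[X]) (hf : f ≠ 0)
    (h : ∀ z : ℂ, aeval z f = 0 → z.re = -(1 / 2)) :
    ∃ v a ts, f = criticalLineProduct v a ts := by
  induction hn : f.natDegree using Nat.strong_induction_on generalizing f with
  | _ m ih =>
  by_cases h0 : f.natDegree = 0
  · refine ⟨f.coeff 0, 0, [], ?_⟩
    simpa [criticalLineProduct] using eq_C_of_natDegree_eq_zero h0
  obtain ⟨z, hz⟩ := IsAlgClosed.exists_aeval_eq_zero ℂ f fun h => h0 (natDegree_eq_of_degree_eq_some h)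
  have hre := h z hz
  have step : ∀ (p g : ℝ[X]), f = p * g → 0 < p.natDegree →
      ∃ v a ts, g = criticalLineProduct v a ts := by
    rintro p g rfl hp
    have hp0 : p ≠ 0 := left_ne_zero_of_mul hf
    have hg0 : g ≠ 0 := right_ne_zero_of_mul hf
    refine ih _ ?_ g hg0 (fun w hw => h w (by simp [hw])) rfl
    rw [← hn, natDegree_mul hp0 hg0]
    omega
  by_cases him : z.im = 0
  · have hz' : z = algebraMap ℝ ℂ (-(1 / 2)) := by
      apply Complex.ext <;> simp [hre, him]
    have hroot : f.IsRoot (-(1 / 2)) := by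
      rw [hz', aeval_algebraMap_apply] at hz
      simpa [IsRoot.def, aeval_def] using hz
    obtain ⟨g, hg⟩ := dvd_iff_isRoot.2 hroot
    obtain ⟨v, a, ts, rfl⟩ := step _ g hg (by simp only [natDegree_X_sub_C]; norm_num)
    refine ⟨v, a + 1, ts, ?_⟩
    rw [hg]
    simp only [criticalLineProduct, C_neg]
    ring
  · obtain ⟨g, hg⟩ := quadratic_dvd_of_aeval_eq_zero_im_ne_zero f hz him
    have hq : (X ^ 2 - C (2 * z.re) * X + C (‖z‖ ^ 2) : ℝ[X]) =
        (X + C (1 / 2)) ^ 2 + C (z.im ^ 2) := by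
      rw [Complex.sq_norm, Complex.normSq_apply, hre]
      have : (-(1 / 2) * -(1 / 2) + z.im * z.im : ℝ) = (1 / 2) ^ 2 + z.im ^ 2 := by ring
      rw [this, show (2 * -(1 / 2) : ℝ) = -(1 / 2 + 1 / 2) by ring]
      simp only [C_add, C_neg, C_pow]
      ring
    rw [hq] at hg
    have hd : ((X + C (1 / 2)) ^ 2 + C (z.im ^ 2) : ℝ[X]).natDegree = 2 := by
      compute_degree!
    obtain ⟨v, a, ts, rfl⟩ := step _ g hg (by rw [hd]; norm_num)
    refine ⟨v, a, z.im :: ts, ?_⟩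
    rw [hg]
    simp only [criticalLineProduct, List.map_cons, List.prod_cons]
    ring

theorem natDegree_criticalLineProduct {v : ℝ} (hv : v ≠ 0) (a : ℕ) (ts : List ℝ) :
    (criticalLineProduct v a ts).natDegree = a + 2 * ts.length ∧
      (criticalLineProduct v a ts).leadingCoeff = v := by
  have hm : ((X + C (1 / 2) : ℝ[X]) ^ a).Monic := (monic_X_add_C _).pow _
  have hl : (ts.map fun t => ((X + C (1 / 2)) ^ 2 + C (t ^ 2) : ℝ[X])).prod.Monic ∧
      (ts.map fun t => ((X + C (1 / 2)) ^ 2 + C (t ^ 2) : ℝ[X])).prod.natDegree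
        = 2 * ts.length := by
    induction ts with
    | nil => simp
    | cons t ts ih =>
      have hq : ((X + C (1 / 2)) ^ 2 + C (t ^ 2) : ℝ[X]).Monic := by
        monicity!
      have hd : ((X + C (1 / 2)) ^ 2 + C (t ^ 2) : ℝ[X]).natDegree = 2 := by
        compute_degree!
      rw [List.map_cons, List.prod_cons]
      refine ⟨hq.mul ih.1, ?_⟩
      rw [hq.natDegree_mul ih.1, hd, ih.2, List.length_cons]
      ring
  rw [criticalLineProduct, mul_assoc]
  constructor
  · rw [natDegree_C_mul hv, hm.natDegree_mul hl.1, hl.2, natDegree_pow, natDegree_X_add_C, mul_one]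
  · rw [leadingCoeff_mul, leadingCoeff_C, (hm.mul hl.1).leadingCoeff, mul_one]

theorem eval_criticalLineProduct (v : ℝ) (a : ℕ) (ts : List ℝ) (x : ℝ) :
    (criticalLineProduct v a ts).eval x =
      v * (x + 1 / 2) ^ a * (ts.map fun t => (x + 1 / 2) ^ 2 + t ^ 2).prod := by
  simp [criticalLineProduct, eval_list_prod, Function.comp_def]

theorem pow_le_prod_sq_add_sq (y : ℝ) (ts : List ℝ) :
    (y ^ 2) ^ ts.length ≤ (ts.map fun t => y ^ 2 + t ^ 2).prod := by
  induction ts with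
  | nil => simp
  | cons t ts ih =>
    rw [List.map_cons, List.prod_cons, List.length_cons, pow_succ']
    exact mul_le_mul (by nlinarith [sq_nonneg t]) ih (by positivity) (by positivity)

theorem le_prod_sq_add_sq_of_mem (y : ℝ) {ts : List ℝ} {t : ℝ} (ht : t ∈ ts) :
    (y ^ 2) ^ (ts.length - 1) * (y ^ 2 + t ^ 2) ≤ (ts.map fun t => y ^ 2 + t ^ 2).prod := by
  have hp := List.perm_cons_erase ht
  rw [(hp.map _).prod_eq, hp.length_eq, List.map_cons, List.prod_cons, List.length_cons,
    Nat.add_sub_cancel, mul_comm]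
  exact mul_le_mul_of_nonneg_left (pow_le_prod_sq_add_sq y _) (by positivity)

theorem magicPositive_comp_criticalLineProduct {v : ℝ} (hv : 0 < v) (a : ℕ) (ts : List ℝ) {k : ℝ}
    (hk : 1 / 2 ≤ k) (hts : ∀ t ∈ ts, 1 / 2 + 2 * t ^ 2 ≤ k) :
    MagicPositive ((criticalLineProduct v a ts).comp (C k * X)) := by
  have hk0 : k ≠ 0 := by linarith
  have hdeg : ((criticalLineProduct v a ts).comp (C k * X)).natDegree = 2 * ts.length + a := by
    rw [natDegree_comp, natDegree_C_mul_X _ hk0, mul_one,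
      (natDegree_criticalLineProduct hv.ne' a ts).1, add_comm]
  suffices h : MagicCone (2 * ts.length + a) ((criticalLineProduct v a ts).comp (C k * X)) by
    rw [← hdeg] at h
    exact h
  clear hdeg
  induction ts with
  | nil =>
    induction a with
    | zero => simpa [criticalLineProduct] using MagicCone.const hv.le
    | succ a ih =>
      rw [← add_assoc]
      convert ih.linear_mul hk using 1
      simp [criticalLineProduct, pow_succ]
      ring
  | cons t ts ih =>
    convert (ih fun s hs => hts s (List.mem_cons_of_mem _ hs)).quadratic_mul
      (hts t List.mem_cons_self) using 1
    · rw [List.length_cons]; ring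
    · simp [criticalLineProduct]
      ring

/-! ### Convex geometry of reflexive polytopes -/

theorem intPoint_add {n : ℕ} (x y : Fin n → ℤ) : intPoint (x + y) = intPoint x + intPoint y := by
  ext i; simp [intPoint]

theorem intPoint_smul {n : ℕ} (c : ℤ) (x : Fin n → ℤ) :
    intPoint (c • x) = (c : ℝ) • intPoint x := by
  ext i; simp [intPoint]

namespace IsLatticePolytope

variable {n : ℕ} {P : Set (Fin n → ℝ)}

theorem isCompact (hP : IsLatticePolytope P) : IsCompact P := by
  obtain ⟨S, -, rfl⟩ := hP
  exact (S.finite_toSet.image _).isCompact_convexHull ℝ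

theorem convex (hP : IsLatticePolytope P) : Convex ℝ P := by
  obtain ⟨S, -, rfl⟩ := hP
  exact convex_convexHull ℝ _

theorem nonempty (hP : IsLatticePolytope P) : P.Nonempty := by
  obtain ⟨S, hS, rfl⟩ := hP
  exact (Set.Nonempty.image _ hS).convexHull

end IsLatticePolytope

/-- If the dual of `P` is bounded, a linear form which is nonpositive on `P` vanishes. -/
theorem eq_zero_of_nonpos_of_isCompact_dualPolytope {n : ℕ} {P : Set (Fin n → ℝ)}
    (hP : IsCompact (dualPolytope P)) (f : (Fin n → ℝ) →ₗ[ℝ] ℝ) (hf : ∀ x ∈ P, f x ≤ 0) :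
    f = 0 := by
  set y : Fin n → ℝ := (dotProductEquiv ℝ (Fin n)).symm f with hy
  have hfy : ∀ x, x ⬝ᵥ y = f x := fun x => by
    have : dotProductEquiv ℝ (Fin n) y = f := by simp [hy]
    rw [← this, dotProduct_comm]; rfl
  -- The whole ray through `y` lies in the dual, so boundedness forces `y = 0`.
  have hmem : ∀ t : ℕ, (t : ℝ) • y ∈ dualPolytope P := fun t x hx => by
    rw [dotProduct_smul, hfy, smul_eq_mul]
    exact (mul_nonpos_of_nonneg_of_nonpos t.cast_nonneg (hf x hx)).trans zero_le_one
  obtain ⟨r, hr⟩ := hP.isBounded.exists_norm_le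
  have hy0 : y = 0 := by
    by_contra h
    obtain ⟨t, ht⟩ := exists_nat_gt (r / ‖y‖)
    have h1 := hr _ (hmem t)
    rw [norm_smul, Real.norm_natCast] at h1
    rw [div_lt_iff₀ (norm_pos_iff.2 h)] at ht
    linarith
  rw [hy] at hy0
  simpa using hy0

namespace IsReflexivePolytope

variable {n : ℕ} {P : Set (Fin n → ℝ)}

/-- A hyperplane separating `0` from `P` would give a linear form negative on `P`, contrary to the
vanishing of such forms. -/
theorem zero_mem (hP : IsReflexivePolytope P) : (0 : Fin n → ℝ) ∈ P := by
  by_contra h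
  obtain ⟨f, u, hu, hf⟩ :=
    geometric_hahn_banach_closed_point hP.1.convex hP.1.isCompact.isClosed h
  rw [map_zero] at hf
  have h0 := eq_zero_of_nonpos_of_isCompact_dualPolytope hP.2.isCompact f.toLinearMap
    fun x hx => ((hu x hx).trans hf).le
  obtain ⟨x, hx⟩ := hP.1.nonempty
  have h1 : f x = 0 := LinearMap.congr_fun h0 x
  linarith [hu x hx]

theorem exists_lattice_basis (hP : IsReflexivePolytope P) :
    ∃ v : Fin n → Fin n → ℤ, (∀ i, intPoint (v i) ∈ P) ∧ (Matrix.of v).det ≠ 0 := by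
  obtain ⟨S, -, hS⟩ := hP.1
  set T : Set (Fin n → ℝ) := intPoint '' (S : Set (Fin n → ℤ)) with hT
  have hspan : Submodule.span ℝ T = ⊤ := by
    by_contra h
    obtain ⟨f, hf, hker⟩ := Submodule.exists_le_ker_of_lt_top _ (lt_top_iff_ne_top.2 h)
    refine hf (eq_zero_of_nonpos_of_isCompact_dualPolytope hP.2.isCompact f fun x hx => ?_)
    rw [hS] at hx
    exact (LinearMap.mem_ker.1 (hker (convexHull_min Submodule.subset_span (Submodule.convex _) hx))).le
  obtain ⟨b, hbT, hbs, hbl⟩ := exists_linearIndependent ℝ T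
  let B : Module.Basis b ℝ (Fin n → ℝ) :=
    Module.Basis.mk hbl (by rw [Subtype.range_coe, hbs, hspan])
  let e : b ≃ Fin n := B.indexEquiv (Pi.basisFun ℝ (Fin n))
  have hv : ∀ i : Fin n, ∃ z ∈ S, intPoint z = (e.symm i : Fin n → ℝ) :=
    fun i => hbT (e.symm i).2
  choose v hvS hv using hv
  refine ⟨v, fun i => hS ▸ subset_convexHull ℝ _ ⟨v i, hvS i, rfl⟩, fun hdet => ?_⟩
  have hli : LinearIndependent ℝ ((Matrix.of v).map (Int.castRingHom ℝ)).row := by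
    have h1 := hbl.comp _ e.symm.injective
    have h2 : ((Matrix.of v).map (Int.castRingHom ℝ)).row = Subtype.val ∘ e.symm :=
      funext fun i => hv i
    rwa [h2]
  rw [Matrix.linearIndependent_rows_iff_isUnit, Matrix.isUnit_iff_isUnit_det] at hli
  refine hli.ne_zero ?_
  rw [← RingHom.mapMatrix_apply, ← RingHom.map_det, hdet, map_zero]

theorem polytopeDim_eq (hP : IsReflexivePolytope P) : polytopeDim P = n := by
  have hspan : Submodule.span ℝ P = ⊤ := by
    by_contra h
    obtain ⟨f, hf, hker⟩ := Submodule.exists_le_ker_of_lt_top _ (lt_top_iff_ne_top.2 h)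
    exact hf (eq_zero_of_nonpos_of_isCompact_dualPolytope hP.2.isCompact f fun x hx =>
      (LinearMap.mem_ker.1 (hker (Submodule.subset_span hx))).le)
  have h : vectorSpan ℝ P = ⊤ := by
    rw [vectorSpan_eq_span_vsub_set_right ℝ hP.zero_mem]
    simpa using hspan
  rw [polytopeDim, h, finrank_top, Module.finrank_fin_fun]

end IsReflexivePolytope

/-! ### Counting lattice points in dilates -/

/-- The lattice points of the dilates of a bounded set lie in cubes of proportional size. -/
theorem exists_latticePoints_subset_Icc {n : ℕ} {P : Set (Fin n → ℝ)}
    (hP : Bornology.IsBounded P) :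
    ∃ R : ℕ, ∀ m : ℕ, {z : Fin n → ℤ | intPoint z ∈ (m : ℝ) • P} ⊆
      Set.Icc (fun _ => -((R * m : ℕ) : ℤ)) (fun _ => ((R * m : ℕ) : ℤ)) := by
  obtain ⟨r, hr⟩ := hP.exists_norm_le
  obtain ⟨R, hR⟩ := exists_nat_ge r
  refine ⟨R, fun m z hz => ?_⟩
  obtain ⟨x, hx, hxz⟩ := hz
  have key : ∀ i, |z i| ≤ ((R * m : ℕ) : ℤ) := fun i => by
    have h1 : (z i : ℝ) = m * x i := by
      have := congrFun hxz i
      simpa [intPoint] using this.symm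
    have h2 : |x i| ≤ R := (norm_le_pi_norm x i).trans ((hr x hx).trans hR)
    have h3 : |(z i : ℝ)| ≤ R * m := by
      rw [h1, abs_mul, Nat.abs_cast, mul_comm]
      exact mul_le_mul_of_nonneg_right h2 m.cast_nonneg
    exact_mod_cast h3
  exact ⟨fun i => (abs_le.1 (key i)).1, fun i => (abs_le.1 (key i)).2⟩

theorem finite_latticePoints {n : ℕ} {P : Set (Fin n → ℝ)} (hP : Bornology.IsBounded P) (m : ℕ) :
    {z : Fin n → ℤ | intPoint z ∈ (m : ℝ) • P}.Finite := by
  obtain ⟨R, hR⟩ := exists_latticePoints_subset_Icc hP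
  exact (Set.finite_Icc _ _).subset (hR m)

theorem exists_latticePointCount_le {n : ℕ} {P : Set (Fin n → ℝ)}
    (hP : Bornology.IsBounded P) :
    ∃ R : ℕ, ∀ m : ℕ, latticePointCount ((m : ℝ) • P) ≤ (2 * (R * m) + 1) ^ n := by
  obtain ⟨R, hR⟩ := exists_latticePoints_subset_Icc hP
  refine ⟨R, fun m => (Set.ncard_le_ncard (hR m) (Set.finite_Icc _ _)).trans ?_⟩
  rw [← Finset.coe_Icc, Set.ncard_coe_finset, Pi.card_Icc]
  simp only [Int.card_Icc, Finset.prod_const, Finset.card_univ, Fintype.card_fin]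
  refine le_of_eq ?_
  congr 1
  omega

section Dilates

variable {n : ℕ} {P : Set (Fin n → ℝ)}

theorem smul_subset_smul_of_le (hc : Convex ℝ P) (h0 : (0 : Fin n → ℝ) ∈ P) {a b : ℝ}
    (ha : 0 ≤ a) (hab : a ≤ b) : a • P ⊆ b • P := by
  have h : b • P = a • P + (b - a) • P := by
    rw [← hc.add_smul ha (sub_nonneg.2 hab), add_sub_cancel]
  rw [h]
  intro x hx
  exact ⟨x, hx, 0, ⟨0, h0, smul_zero _⟩, add_zero _⟩

theorem sum_smul_mem_smul {ι : Type*} (hc : Convex ℝ P) (h0 : (0 : Fin n → ℝ) ∈ P)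
    (s : Finset ι) (k : ι → ℝ) (hk : ∀ i, 0 ≤ k i) (v : ι → Fin n → ℝ) (hv : ∀ i, v i ∈ P) :
    ∑ i ∈ s, k i • v i ∈ (∑ i ∈ s, k i) • P := by
  classical
  induction s using Finset.induction_on with
  | empty => exact ⟨0, h0, by simp⟩
  | insert i s hi ih =>
    rw [Finset.sum_insert hi, Finset.sum_insert hi,
      hc.add_smul (hk i) (Finset.sum_nonneg fun j _ => hk j)]
    exact Set.add_mem_add (Set.smul_mem_smul_set (hv i)) ih

/-- For linearly independent lattice points `vᵢ ∈ P` and `N` coprime to their determinant, the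
points `N x + ∑ kᵢ vᵢ` with `0 ≤ kᵢ < N` and `x` a lattice point are pairwise distinct. -/
theorem sum_latticePointCount_smul_le (hc : Convex ℝ P) (h0 : (0 : Fin n → ℝ) ∈ P)
    (hb : Bornology.IsBounded P) (v : Fin n → Fin n → ℤ) (hv : ∀ i, intPoint (v i) ∈ P) (N K : ℕ)
    (hN : IsCoprime (N : ℤ) (Matrix.of v).det) (j : (Fin n → Fin N) → ℕ)
    (hj : ∀ k, N * j k + ∑ i, (k i : ℕ) ≤ K) :
    ∑ k, latticePointCount ((j k : ℝ) • P) ≤ latticePointCount ((K : ℝ) • P) := by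
  have hcard : ∀ m : ℕ, latticePointCount ((m : ℝ) • P) =
      (finite_latticePoints hb m).toFinset.card := fun m => Set.ncard_eq_toFinset_card _ _
  simp only [hcard]
  rw [← Finset.card_sigma]
  refine Finset.card_le_card_of_injOn
    (fun p => (N : ℤ) • p.2 + ∑ i, ((p.1 i : ℕ) : ℤ) • v i) ?_ ?_
  · rintro ⟨k, x⟩ hx
    simp only [Finset.coe_sigma, Set.mem_sigma_iff, Set.Finite.coe_toFinset,
      Set.mem_ofPred_eq] at hx ⊢
    have hsum : intPoint (∑ i, ((k i : ℕ) : ℤ) • v i) = ∑ i, ((k i : ℕ) : ℝ) • intPoint (v i) := by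
      ext l; simp [intPoint]
    rw [intPoint_add, intPoint_smul, hsum]
    have h1 : ((N * j k + ∑ i, (k i : ℕ) : ℕ) : ℝ) ≤ K := by exact_mod_cast hj k
    refine smul_subset_smul_of_le hc h0 (Nat.cast_nonneg _) h1 ?_
    rw [Nat.cast_add, hc.add_smul (Nat.cast_nonneg _) (Nat.cast_nonneg _)]
    refine Set.add_mem_add ?_ ?_
    · rw [Nat.cast_mul, mul_smul, Int.cast_natCast]
      exact Set.smul_mem_smul_set hx.2
    · rw [Nat.cast_sum]
      exact sum_smul_mem_smul hc h0 _ _ (fun _ => Nat.cast_nonneg _) _ hv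
  · rintro ⟨k, x⟩ - ⟨k', x'⟩ - h
    simp only at h
    have hvec : ∀ k : Fin n → Fin N, ∑ i, ((k i : ℕ) : ℤ) • v i =
        Matrix.vecMul (fun i => ((k i : ℕ) : ℤ)) (Matrix.of v) := fun k => by
      ext l; simp [Matrix.vecMul, dotProduct]
    rw [hvec, hvec] at h
    -- Multiplying by the adjugate isolates `det * kᵢ` modulo `N`; as `N` is coprime to `det` and
    -- `kᵢ < N`, this determines `k`.
    have hadj := congrArg (fun w => Matrix.vecMul w (Matrix.of v).adjugate) h
    simp only [Matrix.add_vecMul, Matrix.vecMul_vecMul, Matrix.mul_adjugate, Matrix.smul_vecMul,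
      Matrix.vecMul_smul, Matrix.vecMul_one] at hadj
    have hk : k = k' := by
      funext i
      have hi := congrFun hadj i
      simp only [Pi.add_apply, Pi.smul_apply, smul_eq_mul] at hi
      have hdvd : (N : ℤ) ∣ (Matrix.of v).det * (((k i : ℕ) : ℤ) - ((k' i : ℕ) : ℤ)) :=
        
        ⟨Matrix.vecMul x' (Matrix.of v).adjugate i - Matrix.vecMul x (Matrix.of v).adjugate i, by
          linear_combination hi⟩
      have h2 := Int.modEq_iff_dvd.2 (hN.dvd_of_dvd_mul_left hdvd)
      have h3 : (k' i : ℕ) ≡ (k i : ℕ) [MOD N] := Int.natCast_modEq_iff.1 h2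
      exact Fin.ext (Nat.ModEq.eq_of_lt_of_lt h3 (k' i).2 (k i).2).symm
    subst hk
    have hx : x = x' := by
      -- For `n = 0` the number `N` may be zero and cannot be cancelled.
      by_cases hn : n = 0
      · subst hn; exact Subsingleton.elim _ _
      have hN0 : (N : ℤ) ≠ 0 := by
        have := (k ⟨0, Nat.pos_of_ne_zero hn⟩).pos
        exact_mod_cast this.ne'
      exact smul_right_injective _ hN0 (add_right_cancel h)
    rw [hx]

end Dilates

/-! ### Growth of polynomials and convexity of powers -/

open Filter in
theorem tendsto_eval_div_pow (f : ℝ[X]) {n : ℕ} (hn : f.natDegree ≤ n) :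
    Tendsto (fun x : ℝ => f.eval x / x ^ n) atTop (nhds (f.coeff n)) := by
  have hX : (X ^ n : ℝ[X]).degree = n := degree_X_pow n
  rcases eq_or_ne f 0 with rfl | hf
  · simp
  rcases hn.lt_or_eq with h | h
  · have := f.div_tendsto_atTop_zero_of_degree_lt (X ^ n)
      (by rw [hX, degree_eq_natDegree hf]; exact_mod_cast h)
    simpa [coeff_eq_zero_of_natDegree_lt h] using this
  · have := f.div_tendsto_atTop_leadingCoeff_div_of_degree_eq (X ^ n)
      (by rw [hX, degree_eq_natDegree hf, h])
    simpa [leadingCoeff, h] using this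

open Filter in
theorem natDegree_le_of_eval_natCast_le (f : ℝ[X]) (n : ℕ) (c : ℝ) (hf : 0 < f.leadingCoeff)
    (h : ∀ m : ℕ, 0 < m → f.eval (m : ℝ) ≤ c * (m : ℝ) ^ n) : f.natDegree ≤ n := by
  by_contra! hn
  have hf0 : f ≠ 0 := by rintro rfl; simp at hf
  have h1 := f.div_tendsto_atTop_of_degree_gt (X ^ n)
    (by rw [degree_X_pow, degree_eq_natDegree hf0]; exact_mod_cast hn)
    (pow_ne_zero _ X_ne_zero) (by simpa using hf.le)
  have h2 := (h1.comp tendsto_natCast_atTop_atTop).eventually_gt_atTop c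
  obtain ⟨m, hm, hm0⟩ := (h2.and (eventually_gt_atTop 0)).exists
  have hm' : (0 : ℝ) < (m : ℝ) ^ n := by positivity
  simp only [Function.comp_apply, eval_pow, eval_X] at hm
  rw [lt_div_iff₀ hm'] at hm
  exact absurd (h m hm0) (not_le.2 hm)

/-- Monotonicity and convexity of powers; this supplies the hypothesis on `g` in the averaging
inequality. -/
theorem two_mul_pow_le_pow_add_pow {p q y : ℝ} (hp : 0 ≤ p) (hq : 0 ≤ q) (hy : 0 ≤ y)
    (h : 2 * y ≤ p + q) (k : ℕ) : 2 * y ^ k ≤ p ^ k + q ^ k := by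
  cases k with
  | zero => norm_num
  | succ k =>
    have h1 := (pow_le_pow_left₀ (by positivity) h (k + 1)).trans (add_pow_le hp hq (k + 1))
    rw [mul_pow, pow_succ 2 k, Nat.add_sub_cancel, mul_assoc] at h1
    exact le_of_mul_le_mul_left h1 (by positivity)

/-! ### Degree and root bounds for Ehrhart polynomials -/

section Ehrhart

variable {n : ℕ} {P : Set (Fin n → ℝ)} {E : ℝ[X]}

theorem CountsDilates.one_le_eval (hP : IsReflexivePolytope P) (hE : CountsDilates P E) {m : ℕ}
    (hm : 0 < m) : 1 ≤ E.eval (m : ℝ) := by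
  rw [hE m hm]
  have h : 0 < latticePointCount ((m : ℝ) • P) := by
    rw [latticePointCount, Set.ncard_pos (finite_latticePoints hP.1.isCompact.isBounded m)]
    refine ⟨0, 0, hP.zero_mem, ?_⟩
    ext i; simp [intPoint]
  exact_mod_cast h

/-- The averaging inequality: a midpoint convex lower bound of `E` at level `M - (n + 1) / 2` is
at most `E (N M) / Nⁿ`. -/
theorem CountsDilates.pow_mul_le_eval (hP : IsReflexivePolytope P) (hE : CountsDilates P E)
    (v : Fin n → Fin n → ℤ) (hv : ∀ i, intPoint (v i) ∈ P) {N M : ℕ} (hN0 : 0 < N)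
    (hN : IsCoprime (N : ℤ) (Matrix.of v).det) (hM : n + 1 ≤ M) (g : ℝ → ℝ) {y : ℝ}
    (hy : y = M - ((n : ℝ) + 1) / 2)
    (hg : ∀ p q, 0 ≤ p → 0 ≤ q → 2 * y ≤ p + q → 2 * g y ≤ g p + g q)
    (hgE : ∀ m : ℕ, 0 < m → g (m + 1 / 2) ≤ E.eval (m : ℝ)) :
    (N : ℝ) ^ n * g y ≤ E.eval ((N : ℝ) * M) := by
  have hsum : ∀ k : Fin n → Fin N, ∑ i, (k i : ℕ) ≤ n * N := fun k => by
    calc ∑ i, (k i : ℕ) ≤ ∑ _i : Fin n, N := Finset.sum_le_sum fun i _ => (k i).2.le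
      _ = n * N := by simp
  have hNM : n * N + N ≤ N * M := by nlinarith
  -- The largest dilate for which the family of `k` still fits into `N M P`.
  let j : (Fin n → Fin N) → ℕ := fun k => (N * M - ∑ i, (k i : ℕ)) / N
  have hjle : ∀ k, N * j k + ∑ i, (k i : ℕ) ≤ N * M := fun k => by
    have h1 := Nat.mul_div_le (N * M - ∑ i, (k i : ℕ)) N
    have h2 := hsum k
    change N * ((N * M - ∑ i, (k i : ℕ)) / N) + _ ≤ _
    omega
  have hjpos : ∀ k, 0 < j k := fun k => by
    have h2 := hsum k
    exact Nat.div_pos (by omega) hN0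
  have hjlt : ∀ k, N * M < N * j k + N + ∑ i, (k i : ℕ) := fun k => by
    have h1 := Nat.lt_mul_div_succ (N * M - ∑ i, (k i : ℕ)) hN0
    have h2 := hsum k
    rw [mul_add, mul_one] at h1
    change _ < N * ((N * M - ∑ i, (k i : ℕ)) / N) + N + _
    omega
  have hcount : ∑ k, E.eval (j k : ℝ) ≤ E.eval ((N : ℝ) * M) := by
    have h1 := sum_latticePointCount_smul_le hP.1.convex hP.zero_mem hP.1.isCompact.isBounded
      v hv N (N * M) hN j hjle
    have h2 := hE (N * M) (Nat.mul_pos hN0 (by omega))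
    rw [Nat.cast_mul] at h2 h1
    rw [h2, Finset.sum_congr rfl fun k _ => hE (j k) (hjpos k)]
    exact_mod_cast h1
  -- The reflection `kᵢ ↦ N - 1 - kᵢ` pairs the families so that `(j k + 1/2) + (j (r k) + 1/2) ≥ 2M
  -- - n - 1 = 2y`.
  let r : (Fin n → Fin N) ≃ (Fin n → Fin N) := Equiv.piCongrRight fun _ => Fin.revPerm
  have hrev : ∑ k, E.eval (j (r k) : ℝ) = ∑ k, E.eval (j k : ℝ) :=
    Equiv.sum_comp r fun k => E.eval (j k : ℝ)
  have hpair : ∀ k, 2 * g y ≤ E.eval (j k : ℝ) + E.eval (j (r k) : ℝ) := fun k => by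
    refine (hg _ _ (by positivity) (by positivity) ?_).trans
      (add_le_add (hgE _ (hjpos k)) (hgE _ (hjpos (r k))))
    have h1 := hjlt k
    have h2 := hjlt (r k)
    have h3 : ∑ i, (k i : ℕ) + ∑ i, (r k i : ℕ) ≤ n * N := by
      rw [← Finset.sum_add_distrib]
      calc ∑ i, ((k i : ℕ) + (r k i : ℕ)) ≤ ∑ _i : Fin n, N := Finset.sum_le_sum fun i _ => by
            have : (r k i : ℕ) = N - (k i + 1) := Fin.val_rev _
            omega
        _ = n * N := by simp
    have h4 : N * (2 * M) ≤ N * (j k + j (r k) + 2 + n) := by linarith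
    have h5 : 2 * M ≤ j k + j (r k) + 2 + n := Nat.le_of_mul_le_mul_left h4 hN0
    have h6 : (2 * M : ℝ) ≤ j k + j (r k) + 2 + n := by exact_mod_cast h5
    rw [hy]
    linarith
  have htotal : ∑ _k : Fin n → Fin N, 2 * g y ≤
      ∑ k, (E.eval (j k : ℝ) + E.eval (j (r k) : ℝ)) := Finset.sum_le_sum fun k _ => hpair k
  rw [Finset.sum_add_distrib, hrev] at htotal
  simp only [Finset.sum_const, Finset.card_univ, Fintype.card_pi, Fintype.card_fin,
    Finset.prod_const, nsmul_eq_mul, Nat.cast_pow] at htotal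
  linarith

open Filter in
theorem CountsDilates.le_coeff_mul_pow (hP : IsReflexivePolytope P) (hE : CountsDilates P E)
    (hdeg : E.natDegree ≤ n) {M : ℕ} (hM : n + 1 ≤ M) (g : ℝ → ℝ) {y : ℝ}
    (hy : y = M - ((n : ℝ) + 1) / 2)
    (hg : ∀ p q, 0 ≤ p → 0 ≤ q → 2 * y ≤ p + q → 2 * g y ≤ g p + g q)
    (hgE : ∀ m : ℕ, 0 < m → g (m + 1 / 2) ≤ E.eval (m : ℝ)) :
    g y ≤ E.coeff n * (M : ℝ) ^ n := by
  obtain ⟨v, hv, hdet⟩ := hP.exists_lattice_basis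
  set D := (Matrix.of v).det
  have hM0 : (0 : ℝ) < M := by exact_mod_cast (by omega : 0 < M)
  -- The values `N = 1 + |D| r` are coprime to `D` and tend to infinity.
  have hN : Tendsto (fun r : ℕ => ((1 + D.natAbs * r : ℕ) : ℝ) * M) atTop atTop := by
    refine Tendsto.atTop_mul_const hM0 (tendsto_natCast_atTop_atTop.comp ?_)
    refine tendsto_atTop_mono (fun r => ?_) tendsto_id
    have := Nat.le_mul_of_pos_left r (Int.natAbs_pos.2 hdet)
    simp only [id]
    omega
  have hlim := ((tendsto_eval_div_pow E hdeg).comp hN).mul_const ((M : ℝ) ^ n)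
  refine ge_of_tendsto' hlim fun r => ?_
  have hcop : IsCoprime ((1 + D.natAbs * r : ℕ) : ℤ) D := by
    obtain ⟨c, hc⟩ : D ∣ ((D.natAbs * r : ℕ) : ℤ) := by
      rw [Nat.cast_mul]
      exact (Int.dvd_natAbs.2 dvd_rfl).mul_right _
    refine ⟨1, -c, ?_⟩
    rw [Nat.cast_add, hc]
    push_cast
    ring
  have h := hE.pow_mul_le_eval hP v hv (Nat.add_pos_left one_pos _) hcop hM g hy hg hgE
  have hN0 : (0 : ℝ) < ((1 + D.natAbs * r : ℕ) : ℝ) := Nat.cast_pos.2 (by omega)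
  simp only [Function.comp_apply]
  rw [mul_pow, div_mul_eq_mul_div, mul_div_mul_right _ _ (by positivity),
    le_div_iff₀ (by positivity), mul_comm]
  exact h

variable {v : ℝ} {a : ℕ} {ts : List ℝ}

theorem criticalLineProduct_pos_of_countsDilates (hP : IsReflexivePolytope P)
    (hE : CountsDilates P (criticalLineProduct v a ts)) : 0 < v := by
  have h1 := hE.one_le_eval hP one_pos
  rw [eval_criticalLineProduct, mul_assoc] at h1
  have h2 : 0 ≤ (((1 : ℕ) : ℝ) + 1 / 2) ^ a *
      (ts.map fun t => (((1 : ℕ) : ℝ) + 1 / 2) ^ 2 + t ^ 2).prod :=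
    mul_nonneg (by positivity) ((by positivity : (0 : ℝ) ≤ _).trans (pow_le_prod_sq_add_sq _ ts))
  by_contra! hv
  linarith [mul_nonpos_of_nonpos_of_nonneg hv h2]

/-- Counting in cubes gives degree at most `n`. If it were smaller, the `n`-th coefficient would
vanish, while `CountsDilates.le_coeff_mul_pow` bounds it below by a positive quantity. -/
theorem natDegree_criticalLineProduct_eq (hP : IsReflexivePolytope P)
    (hE : CountsDilates P (criticalLineProduct v a ts)) : a + 2 * ts.length = n := by
  have hv := criticalLineProduct_pos_of_countsDilates hP hE
  obtain ⟨hdeg, hlead⟩ := natDegree_criticalLineProduct hv.ne' a ts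
  obtain ⟨R, hR⟩ := exists_latticePointCount_le hP.1.isCompact.isBounded
  have hle : (criticalLineProduct v a ts).natDegree ≤ n := by
    refine natDegree_le_of_eval_natCast_le _ n ((2 * R + 1) ^ n) (by rwa [hlead]) fun m hm => ?_
    rw [hE m hm, ← mul_pow]
    have h1 : (latticePointCount ((m : ℝ) • P) : ℝ) ≤ (2 * (R * m) + 1) ^ n := by
      exact_mod_cast hR m
    refine h1.trans (pow_le_pow_left₀ (by positivity) ?_ n)
    have : (1 : ℝ) ≤ m := by exact_mod_cast hm
    linarith
  by_contra hne
  have h := hE.le_coeff_mul_pow hP hle (M := n + 1) le_rfl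
    (fun y => v * y ^ (a + 2 * ts.length)) (y := ((n : ℝ) + 1) / 2) (by push_cast; ring)
    (fun p q hp hq hpq => by
      have := two_mul_pow_le_pow_add_pow hp hq (by positivity) hpq (a + 2 * ts.length)
      nlinarith)
    (fun m _ => by
      rw [eval_criticalLineProduct, pow_add, pow_mul, ← mul_assoc]
      exact mul_le_mul_of_nonneg_left (pow_le_prod_sq_add_sq _ ts) (by positivity))
  rw [coeff_eq_zero_of_natDegree_lt (by omega), zero_mul] at h
  have : 0 < v * (((n : ℝ) + 1) / 2) ^ (a + 2 * ts.length) := by positivity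
  exact absurd h (not_le.2 this)

/-- Bernoulli with exponent `n/2 ≥ 1` gives `(1 - 1/n)^(n/2) ≥ 1/2`; then square. -/
theorem pow_le_four_mul_pow {n : ℕ} (hn : 2 ≤ n) : (n : ℝ) ^ n ≤ 4 * ((n : ℝ) - 1) ^ n := by
  have hn' : (2 : ℝ) ≤ n := by exact_mod_cast hn
  have hs : (-1 : ℝ) ≤ -(1 / n) := by
    rw [neg_le_neg_iff, div_le_one (by linarith)]
    linarith
  have h1 := one_add_mul_self_le_rpow_one_add hs (p := (n : ℝ) / 2) (by linarith)
  have h2 : (1 : ℝ) / 2 ≤ (1 + -(1 / n)) ^ ((n : ℝ) / 2) := by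
    refine le_trans (le_of_eq ?_) h1
    field_simp
    norm_num
  have h3 := pow_le_pow_left₀ (by norm_num) h2 2
  rw [← Real.rpow_natCast (_ ^ _), ← Real.rpow_mul (by linarith),
    show (n : ℝ) / 2 * ((2 : ℕ) : ℝ) = n by push_cast; ring, Real.rpow_natCast,
    show (1 : ℝ) + -(1 / n) = (n - 1) / n by field_simp; ring, div_pow (_ - _),
    le_div_iff₀ (by positivity)] at h3
  linarith

/-- The imaginary parts of the Ehrhart roots of a CL-polytope are at most `d (d - 1/2)`. -/
theorem sq_le_of_countsDilates (hP : IsReflexivePolytope P)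
    (hE : CountsDilates P (criticalLineProduct v a ts)) {t : ℝ} (ht : t ∈ ts) :
    t ^ 2 ≤ (n : ℝ) ^ 2 * ((n : ℝ) - 1 / 2) ^ 2 := by
  have hv := criticalLineProduct_pos_of_countsDilates hP hE
  obtain ⟨hdeg, hlead⟩ := natDegree_criticalLineProduct hv.ne' a ts
  have hn := natDegree_criticalLineProduct_eq hP hE
  rw [hn] at hdeg
  have hlen : 0 < ts.length := List.length_pos_of_mem ht
  have hn2 : 2 ≤ n := by omega
  have hn2' : (2 : ℝ) ≤ n := by exact_mod_cast hn2
  -- With `M = n (n + 1) / 2` the ratio `M / y` is `n / (n - 1)`, whose `n`-th power is at most `4`.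
  obtain ⟨M, hM⟩ : 2 ∣ n * (n + 1) := (Nat.even_mul_succ_self n).two_dvd
  have hM' : (M : ℝ) = n * (n + 1) / 2 := by
    have : ((n * (n + 1) : ℕ) : ℝ) = ((2 * M : ℕ) : ℝ) := by rw [hM]
    push_cast at this
    linarith
  set y : ℝ := ((n : ℝ) ^ 2 - 1) / 2 with hy
  have hy0 : 0 < y := by rw [hy]; nlinarith
  have h := hE.le_coeff_mul_pow hP hdeg.le (M := M) (by nlinarith)
    (fun y => v * (y ^ n + t ^ 2 * y ^ (n - 2))) (y := y) (by rw [hM', hy]; ring)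
    (fun p q hp hq hpq => by
      have h1 := two_mul_pow_le_pow_add_pow hp hq hy0.le hpq n
      have h2 := mul_le_mul_of_nonneg_left
        (two_mul_pow_le_pow_add_pow hp hq hy0.le hpq (n - 2)) (sq_nonneg t)
      have h3 := mul_le_mul_of_nonneg_left (add_le_add h1 h2) hv.le
      linarith)
    (fun m _ => by
      rw [eval_criticalLineProduct, mul_assoc]
      refine mul_le_mul_of_nonneg_left ?_ hv.le
      have h1 := mul_le_mul_of_nonneg_left (le_prod_sq_add_sq_of_mem ((m : ℝ) + 1 / 2) ht)
        (by positivity : 0 ≤ ((m : ℝ) + 1 / 2) ^ a)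
      refine le_trans (le_of_eq ?_) h1
      rw [← pow_mul, ← mul_assoc, ← pow_add, show a + 2 * (ts.length - 1) = n - 2 by omega,
        mul_add, ← pow_add, Nat.sub_add_cancel hn2, mul_comm (t ^ 2)])
  have hc : (criticalLineProduct v a ts).coeff n = v := by
    rwa [leadingCoeff, hdeg] at hlead
  rw [hc] at h
  have h1 : y ^ n + t ^ 2 * y ^ (n - 2) ≤ (M : ℝ) ^ n := le_of_mul_le_mul_left h hv
  have h2 : (M : ℝ) ^ n ≤ 4 * y ^ n := by
    have e1 : (M : ℝ) = ((n : ℝ) + 1) / 2 * n := by rw [hM']; ring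
    have e2 : y = ((n : ℝ) + 1) / 2 * (n - 1) := by rw [hy]; ring
    rw [e1, e2, mul_pow, mul_pow]
    have := mul_le_mul_of_nonneg_left (pow_le_four_mul_pow hn2)
      (by positivity : 0 ≤ (((n : ℝ) + 1) / 2) ^ n)
    linarith
  have h3 : y ^ n = y ^ (n - 2) * y ^ 2 := by rw [← pow_add, Nat.sub_add_cancel hn2]
  have h4 : y ^ (n - 2) * t ^ 2 ≤ y ^ (n - 2) * (3 * y ^ 2) := by
    rw [h3] at h1 h2
    linarith
  have h5 : t ^ 2 ≤ 3 * y ^ 2 := le_of_mul_le_mul_left h4 (by positivity)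
  -- The factor `7/4` suffices because its square `49/16` exceeds `3`.
  have h6 : 7 / 4 * y ≤ n * ((n : ℝ) - 1 / 2) := by rw [hy]; nlinarith
  have h7 := pow_le_pow_left₀ (by positivity) h6 2
  rw [mul_pow, mul_pow] at h7
  nlinarith [sq_nonneg y]

theorem CountsDilates.comp_smul (hE : CountsDilates P E) {k : ℕ} (hk : 0 < k) :
    CountsDilates ((k : ℝ) • P) (E.comp (C (k : ℝ) * X)) := fun m hm => by
  rw [smul_smul, ← Nat.cast_mul, ← hE (m * k) (Nat.mul_pos hm hk)]
  simp [mul_comm]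

end Ehrhart

/-! ### The bound on the m-index -/

theorem mainTheorem8 (n d : ℕ) (P : Set (Fin n → ℝ)) (hP : IsCLPolytope P)
    (hd : polytopeDim P = d) :
    IsLeast (magicDilations P) (mIndex P) ∧
      mIndex P ≤ ⌈(1 / 2 + 2 * (d : ℝ) ^ 2 * ((d : ℝ) - 1 / 2) ^ 2 : ℝ)⌉₊ := by
  obtain ⟨hR, hroots⟩ := hP
  rw [hR.polytopeDim_eq] at hd
  subst hd
  -- Without an Ehrhart polynomial, the zero polynomial would have all its roots on the line.
  have hexists : ∃ E : ℝ[X], CountsDilates P E := by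
    by_contra h
    have h0 := hroots 0 (by rw [ehrhartPolynomial, dif_neg h]; simp)
    norm_num at h0
  obtain ⟨E, hE⟩ := hexists
  rw [hE.eq_ehrhartPolynomial] at hroots
  have hE0 : E ≠ 0 := by
    rintro rfl
    have h0 := hroots 0 (by simp)
    norm_num at h0
  obtain ⟨v, a, ts, rfl⟩ := exists_eq_criticalLineProduct E hE0 hroots
  set B : ℝ := 1 / 2 + 2 * (n : ℝ) ^ 2 * ((n : ℝ) - 1 / 2) ^ 2 with hB
  have hB0 : 1 / 2 ≤ B := by
    have : 0 ≤ 2 * (n : ℝ) ^ 2 * ((n : ℝ) - 1 / 2) ^ 2 := by positivity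
    linarith
  have hk0 : 0 < ⌈B⌉₊ := Nat.ceil_pos.2 (by linarith)
  have hBk : B ≤ (⌈B⌉₊ : ℝ) := Nat.le_ceil B
  have hmem : ⌈B⌉₊ ∈ magicDilations P := by
    refine ⟨hk0, ?_⟩
    rw [(hE.comp_smul hk0).eq_ehrhartPolynomial]
    refine magicPositive_comp_criticalLineProduct (criticalLineProduct_pos_of_countsDilates hR hE)
      a ts (hB0.trans hBk) fun t ht => ?_
    have := sq_le_of_countsDilates hR hE ht
    linarith
  exact ⟨⟨Nat.sInf_mem ⟨_, hmem⟩, fun k hk => Nat.sInf_le hk⟩, Nat.sInf_le hmem⟩
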